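/- **Conventions.** A *semitopological semigroup* (resp. *semitopological group*) is a Hausdorff topological space with a separately continuous semigroup (resp. group) operation. A semigroup $S$ is *regular* if $x\in xSx$ for every $x\in S$, and *bisimple* if it has exactly one $\mathscr{D}$-class. $E(S)$ denotes the set of idempotents of $S$, ordered by $e\leqslant f$ iff $ef=fe=e$. A bisimple semigroup $S$ is *$I$-bisimple* if $E(S)$ is order isomorphic to $\mathbb{Z}$ under the reverse of the usual order. Here $\mathbb{N}=\{1,2,3,\ldots\}$. For a group $G$ with identity $e$, an endomorphism $\theta$ of $G$ (with $\theta^0=\mathrm{id}$) and a family $(u_n)_{n\in\mathbb{Z}}$ in $G$ with $u_n=e$ for all $n\in\mathbb{N}$, put, for $n\in\mathbb{Z}$, $f_{0,n}=e$ and, for $m\in\mathbb{N}$, $$f_{m,n}=\theta^{m-1}(u_{n+1})\,\theta^{m-2}(u_{n+2})\cdots\theta(u_{n+m-1})\,u_{n+m}.$$ *Warne's semigroup* $\mathscr{B}_W$ is the set $\mathbb{Z}\times G\times\mathbb{Z}$ with the multiplication $$(a,g,b)(c,h,d)=\begin{cases}(a,\ g\,f_{b-c,c}^{-1}\,\theta^{b-c}(h)\,f_{b-c,d},\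 d-c+b), & b\geqslant c,\\ (a-b+c,\ f_{c-b,a}^{-1}\,\theta^{c-b}(g)\,f_{c-b,b}\,h,\ d), & b\leqslant c.\end{cases}$$ For $i,j\in\mathbb{Z}$ let $G_{i,j}=\{(i,g,j): g\in G\}\subseteq\mathscr{B}_W$. **Theorem 3.2.** Let $S$ be a regular $I$-bisimple semitopological semigroup. Then there exist a group $G$ with identity $e$, an endomorphism $\theta$ of $G$, a family $(u_n)_{n\in\mathbb{Z}}$ in $G$ with $u_n=e$ for all $n\in\mathbb{N}$, and a topology on the corresponding semigroup $\mathscr{B}_W$ (not necessarily the product topology) such that: (i) $\mathscr{B}_W$ is a semitopological semigroup and $S$ is topologically isomorphic to $\mathscr{B}_W$; (ii) for all $i,j,k,l\in\mathbb{Z}$ the subspaces $G_{i,j}$ and $G_{k,l}$ of $\mathscr{B}_W$ are homeomorphic; (iii) for all $i,k\in\mathbb{Z}$, $G_{i,i}$ and $G_{k,k}$ are semitopological groups with the multiplication and topology induced from $\mathscr{B}_W$, and they are topologically isomorphic; (iv) for every $i\in\mathbb{Z}$, $\theta$ is a continuous endomorphism of $G$ when $G$ is identified with $G_{i,i}$ via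 $g\mapsto(i,g,i)$ and given the topology induced from $\mathscr{B}_W$; (v) every $(i,g,j)\in\mathscr{B}_W$ has an open neighbourhood $U$ in $\mathscr{B}_W$ with $U\subseteq\bigcup_{k\geqslant0}G_{i-k,j-k}$; (vi) $E(S)$ is a discrete subspace of $S$. -/

import Mathlib

universe v

section Semigroups

variable (S : Type*) [Semigroup S]

/-- A semigroup is regular if `x ∈ xSx` for every `x`. -/
def IsRegularSemigroup : Prop := ∀ x : S, ∃ y : S, x = x * y * x

variable {S}

/-- The principal left ideal `S¹x = {x} ∪ Sx`. -/
def principalLeftIdeal (x : S) : Set S := {y | y = x ∨ ∃ s : S, y = s * x}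

/-- The principal right ideal `xS¹ = {x} ∪ xS`. -/
def principalRightIdeal (x : S) : Set S := {y | y = x ∨ ∃ s : S, y = x * s}

/-- Green's relation `𝓛`. -/
def GreenL (x y : S) : Prop := principalLeftIdeal x = principalLeftIdeal y

/-- Green's relation `𝓡`. -/
def GreenR (x y : S) : Prop := principalRightIdeal x = principalRightIdeal y

/-- Green's relation `𝓓 = 𝓛 ∘ 𝓡`. -/
def GreenD (x y : S) : Prop := ∃ z : S, GreenL x z ∧ GreenR z y

/-- The natural partial order on idempotents: `e ≤ f` iff `ef = fe = e`. -/
def IdempotentLE (e f : {x : S // IsIdempotentElem x}) : Prop :=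
  (e : S) * f = e ∧ (f : S) * e = e

variable (S)

/-- A semigroup is bisimple if it has exactly one `𝓓`-class. -/
def IsBisimple : Prop := Nonempty S ∧ ∀ x y : S, GreenD x y

/-- A bisimple semigroup is `I`-bisimple if its idempotents, under the natural partial order,
are order isomorphic to `ℤ` under the reverse of the usual order. -/
def IsIBisimple : Prop :=
  IsBisimple S ∧
    Nonempty (RelIso (IdempotentLE (S := S)) (fun m n : ℤ => n ≤ m))

end Semigroups

/-- A semitopological group: a Hausdorff space with a separately continuous multiplication
that is a group operation. -/
structure IsSemitopologicalGroup (M : Type*) [Mul M] [TopologicalSpace M] : Prop where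
  t2 : T2Space M
  separatelyContinuous : SeparatelyContinuousMul M
  assoc : ∀ x y z : M, x * y * z = x * (y * z)
  exists_one_inv : ∃ e : M, (∀ x : M, e * x = x ∧ x * e = x) ∧
    ∀ x : M, ∃ y : M, x * y = e ∧ y * x = e

/-- The elements
`f_{m,n} = θ^{m-1}(u_{n+1}) θ^{m-2}(u_{n+2}) ⋯ θ(u_{n+m-1}) u_{n+m}`, with `f_{0,n} = e`. -/
def warneF {G : Type*} [Group G] (θ : Monoid.End G) (u : ℤ → G) (m : ℕ) (n : ℤ) : G :=
  ((List.range m).map fun k : ℕ => (θ ^ (m - 1 - k)) (u (n + (k : ℤ) + 1))).prod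

/-- The underlying set `ℤ × G × ℤ` of Warne's semigroup `B_W` determined by `θ` and `u`.
It carries no topology. -/
@[ext]
structure Warne {G : Type*} [Group G] (θ : Monoid.End G) (u : ℤ → G) where
  left : ℤ
  val : G
  right : ℤ

namespace Warne

variable {G : Type*} [Group G] {θ : Monoid.End G} {u : ℤ → G}

/-- Warne's multiplication:
`(a,g,b)(c,h,d) = (a, g f_{b-c,c}⁻¹ θ^{b-c}(h) f_{b-c,d}, d-c+b)` if `b ≥ c`, and
`(a,g,b)(c,h,d) = (a-b+c, f_{c-b,a}⁻¹ θ^{c-b}(g) f_{c-b,b} h, d)` if `b ≤ c`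
(the two formulas agree if `b = c`). -/
instance : Mul (Warne θ u) where
  mul x y :=
    if y.left ≤ x.right then
      ⟨x.left,
        x.val * (warneF θ u (x.right - y.left).toNat y.left)⁻¹ *
          (θ ^ (x.right - y.left).toNat) y.val *
          warneF θ u (x.right - y.left).toNat y.right,
        y.right - y.left + x.right⟩
    else
      ⟨x.left - x.right + y.left,
        (warneF θ u (y.left - x.right).toNat x.left)⁻¹ *
          (θ ^ (y.left - x.right).toNat) x.val *
          warneF θ u (y.left - x.right).toNat x.right * y.val,
        y.right⟩

theorem mul_of_ge (a b c d : ℤ) (g h : G) (hbc : c ≤ b) :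
    (⟨a, g, b⟩ * ⟨c, h, d⟩ : Warne θ u) =
      ⟨a, g * (warneF θ u (b - c).toNat c)⁻¹ * (θ ^ (b - c).toNat) h *
        warneF θ u (b - c).toNat d, d - c + b⟩ :=
  if_pos hbc

theorem mul_of_le (a b c d : ℤ) (g h : G) (hbc : b ≤ c) :
    (⟨a, g, b⟩ * ⟨c, h, d⟩ : Warne θ u) =
      ⟨a - b + c, (warneF θ u (c - b).toNat a)⁻¹ * (θ ^ (c - b).toNat) g *
        warneF θ u (c - b).toNat b * h, d⟩ := by
  rcases hbc.eq_or_lt with rfl | h'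
  · rw [mul_of_ge _ _ _ _ _ _ le_rfl]
    simp [warneF]
  · exact if_neg (not_le.mpr h')

/-- The set `G_{i,j} = {(i,g,j) : g ∈ G}`. -/
def block (θ : Monoid.End G) (u : ℤ → G) (i j : ℤ) : Set (Warne θ u) :=
  {x | ∃ g : G, x = ⟨i, g, j⟩}

theorem diag_mul (i : ℤ) (g h : G) :
    (⟨i, g, i⟩ * ⟨i, h, i⟩ : Warne θ u) = ⟨i, g * h, i⟩ := by
  rw [mul_of_ge _ _ _ _ _ _ le_rfl]
  simp [warneF]

/-- The set `G_{i,i}` with the multiplication of `B_W`. -/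
def diag (θ : Monoid.End G) (u : ℤ → G) (i : ℤ) : Subsemigroup (Warne θ u) where
  carrier := block θ u i i
  mul_mem' := by
    rintro _ _ ⟨g, rfl⟩ ⟨h, rfl⟩
    exact ⟨g * h, diag_mul i g h⟩

/-- The identification `g ↦ (i,g,i)` of `G` with `G_{i,i}`. -/
def diagEquiv (θ : Monoid.End G) (u : ℤ → G) (i : ℤ) : G ≃* diag θ u i where
  toFun g := ⟨⟨i, g, i⟩, g, rfl⟩
  invFun x := x.1.val
  left_inv _ := rfl
  right_inv := by
    rintro ⟨_, g, rfl⟩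
    rfl
  map_mul' g h := Subtype.ext (diag_mul i g h).symm

theorem warneF_add (m k : ℕ) (n : ℤ) :
    warneF θ u (m + k) n = (θ ^ k) (warneF θ u m n) * warneF θ u k (n + m) := by
  unfold warneF
  rw [List.range_add, List.map_append, List.prod_append, map_list_prod, List.map_map,
    List.map_map]
  congr 2
  · refine List.map_congr_left fun j hj => ?_
    have hj := List.mem_range.mp hj
    have : m + k - 1 - j = k + (m - 1 - j) := by omega
    simp only [Function.comp, this, pow_add]
    rfl
  · refine List.map_congr_left fun j hj => ?_
    have : m + k - 1 - (m + j) = k - 1 - j := by omega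
    simp only [Function.comp, this]
    push_cast
    rw [← add_assoc]

/-- The map `(c,h,d) ↦ (c+k, f_{k,c}⁻¹ θ^k(h) f_{k,d}, d+k)`. -/
def raise (k : ℕ) (x : Warne θ u) : Warne θ u :=
  ⟨x.left + k, (warneF θ u k x.left)⁻¹ * (θ ^ k) x.val * warneF θ u k x.right, x.right + k⟩

theorem mul_eq_raise (x y : Warne θ u) :
    x * y = ⟨x.left + (y.left - x.right).toNat,
      (raise (y.left - x.right).toNat x).val * (raise (x.right - y.left).toNat y).val,
      y.right + (x.right - y.left).toNat⟩ := by
  obtain ⟨a, g, b⟩ := x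
  obtain ⟨c, h, d⟩ := y
  rcases le_total c b with hb | hb
  · rw [mul_of_ge _ _ _ _ _ _ hb]
    have : (c - b).toNat = 0 := by omega
    ext
    · simp [this]
    · simp [this, raise, warneF, mul_assoc]
    · simp only [Int.toNat_of_nonneg (sub_nonneg.mpr hb)]; ring
  · rw [mul_of_le _ _ _ _ _ _ hb]
    have : (b - c).toNat = 0 := by omega
    ext
    · simp only [Int.toNat_of_nonneg (sub_nonneg.mpr hb)]; ring
    · simp [this, raise, warneF, mul_assoc]
    · simp [this]

theorem raise_add_val (m k : ℕ) (x : Warne θ u) :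
    (raise (m + k) x).val =
      (warneF θ u k (x.left + m))⁻¹ * (θ ^ k) (raise m x).val * warneF θ u k (x.right + m) := by
  have : (θ ^ (m + k)) x.val = (θ ^ k) ((θ ^ m) x.val) := by
    rw [add_comm, pow_add]; rfl
  simp only [raise, warneF_add, this, map_mul, map_inv, mul_inv_rev, mul_assoc]

instance : Semigroup (Warne θ u) where
  mul_assoc x y z := by
    set m := (y.left - x.right).toNat with hm
    set n := (x.right - y.left).toNat with hn
    set p := (z.left - y.right).toNat with hp
    set q := (y.right - z.left).toNat with hq
    set m' := (z.left - (y.right + n)).toNat with hm'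
    set n' := (y.right + n - z.left).toNat with hn'
    set p' := (y.left + p - x.right).toNat with hp'
    set q' := (x.right - (y.left + p)).toNat with hq'
    have e1 : p' = m + m' := by omega
    have e2 : p + q' = n + m' := by omega
    have e3 : n' = q + q' := by omega
    have e4 : x.right + m = y.left + n := by omega
    have e5 : y.right + p = z.left + q := by omega
    rw [mul_eq_raise (x * y), mul_eq_raise x (y * z), mul_eq_raise x y, mul_eq_raise y z]
    simp only [← hm, ← hn, ← hp, ← hq, ← hm', ← hn', ← hp', ← hq']
    ext
    · simp only [e1]; push_cast; ring
    · have h1 := raise_add_val m m' x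
      have h2 := raise_add_val n m' y
      have h3 := raise_add_val p q' y
      have h4 := raise_add_val q q' z
      rw [← e2] at h2
      rw [e4] at h1
      rw [e5] at h3
      have k1 : (raise m' (⟨x.left + m, (raise m x).val * (raise n y).val,
          y.right + n⟩ : Warne θ u)).val = (raise (m + m') x).val * (raise (p + q') y).val := by
        rw [h1, h2]
        simp only [raise, map_mul]
        group
      have k2 : (raise q' (⟨y.left + p, (raise p y).val * (raise q z).val,
          z.right + q⟩ : Warne θ u)).val = (raise (p + q') y).val * (raise (q + q') z).val := by
        rw [h3, h4]
        simp only [raise, map_mul]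
        group
      rw [k1, k2, e1, e3, mul_assoc]
    · simp only [e3]; push_cast; ring

end Warne

/-! ### Mutually inverse elements linking two idempotents. -/

section Algebra

variable {S : Type*} [Semigroup S]

/-! The idempotents form a descending chain `e n`, and bisimplicity links `e 0` to each `e n` by
mutually inverse `p n`, `q n`. Conjugation by a linking pair is an order isomorphism between tails
of the chain, hence a shift of indices (`IsIdempotentChain.conj`). So `p 1`, `q 1` may be replaced
by their powers for `n ≥ 0`, and every element of the maximal subgroup at `e 0` commutes with `e 1`.
Then `g ↦ p 1 * g * q 1` is an endomorphism, and the failure of `p k = p 1 * p (k - 1)` is measured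
by group elements `u k`, trivial for `k ≥ 1`. Regularity makes `(i, g, j) ↦ q i * g * p j` an
isomorphism; the products `p k * q l` produce the factors `f` (`Frame.p_mul_q`, `Frame.p_mul_q'`).

The topology is pulled back along this isomorphism. Blocks are matched, and `θ` is realised, by
two-sided translations, which are continuous. In a Hausdorff space the fixed points of a translation
form a closed set; this yields the open neighbourhoods and the discreteness of the idempotents. -/

theorem mul_eq_reassoc {a b c : S} (h : a * b = c) (x : S) : a * (b * x) = c * x := by
  rw [← mul_assoc, h]

/-- `p` and `q` are mutually inverse elements with `p * q = a` and `q * p = b`. -/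
structure Linked (p q a b : S) : Prop where
  pq : p * q = a
  qp : q * p = b
  ap : a * p = p
  qa : q * a = q

namespace Linked

variable {p q a b p' q' c : S}

theorem pb (h : Linked p q a b) : p * b = p := by rw [← h.qp, ← mul_assoc, h.pq, h.ap]

theorem bq (h : Linked p q a b) : b * q = q := by rw [← h.qp, mul_assoc, h.pq, h.qa]

theorem symm (h : Linked p q a b) : Linked q p b a := ⟨h.qp, h.pq, h.bq, h.pb⟩

theorem trans (h : Linked p q a b) (h' : Linked p' q' b c) : Linked (p * p') (q' * q) a c where
  pq := by
    rw [mul_assoc, mul_eq_reassoc h'.pq, h.bq, h.pq]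
  qp := by
    rw [mul_assoc, mul_eq_reassoc h.qp, h'.ap, h'.qp]
  ap := by rw [mul_eq_reassoc h.ap]
  qa := by rw [mul_assoc, h.qa]

theorem inv_unique (h : Linked p q a b) (h' : Linked p q' a b) : q = q' := by
  rw [← h.qa, ← h'.pq, mul_eq_reassoc h.qp, h'.bq]

end Linked

/-! ### Chains of idempotents and conjugation along them. -/

/-- `e` enumerates the idempotents of `S` as a descending chain indexed by `ℤ`. -/
structure IsIdempotentChain (e : ℤ → S) : Prop where
  mul : ∀ m n, e m * e n = e (max m n)
  inj : Function.Injective e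
  surj : ∀ x, IsIdempotentElem x → ∃ n, e n = x

namespace IsIdempotentChain

variable {e : ℤ → S} (he : IsIdempotentChain e)
include he

theorem mul_of_le {m n : ℤ} (h : m ≤ n) : e m * e n = e n := by rw [he.mul, max_eq_right h]

theorem mul_of_ge {m n : ℤ} (h : n ≤ m) : e m * e n = e m := by rw [he.mul, max_eq_left h]

theorem le_of_mul {m n : ℤ} (h : e m * e n = e n) : m ≤ n := by
  rw [he.mul] at h
  exact max_eq_right_iff.mp (he.inj h)

theorem exists_conj {p q : S} {i j : ℤ} (h : Linked p q (e i) (e j)) (k : ℕ) :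
    ∃ n : ℕ, q * e (i + k) * p = e (j + n) := by
  have hid : IsIdempotentElem (q * e (i + k) * p) := by
    change q * e (i + k) * p * (q * e (i + k) * p) = _
    simp only [mul_assoc, mul_eq_reassoc h.pq]
    rw [mul_eq_reassoc (he.mul_of_le (show i ≤ i + k by omega)), mul_eq_reassoc (he.mul_of_ge le_rfl)]
  obtain ⟨n, hn⟩ := he.surj _ hid
  have : j ≤ n := by
    apply he.le_of_mul
    rw [hn, mul_assoc, mul_eq_reassoc h.bq]
  exact ⟨(n - j).toNat, by rw [← hn]; congr 1; omega⟩

/-- Conjugation by `p`, `q` and conjugation back are mutually inverse monotone maps between the two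
tails, and `ℕ` has no order automorphism except the identity. -/
theorem conj {p q : S} {i j : ℤ} (h : Linked p q (e i) (e j)) (k : ℕ) :
    q * e (i + k) * p = e (j + k) := by
  choose φ hφ using he.exists_conj h
  choose ψ hψ using he.exists_conj h.symm
  have aux : ∀ {p q : S} {i j : ℤ}, Linked p q (e i) (e j) → ∀ {φ ψ : ℕ → ℕ},
      (∀ k : ℕ, q * e (i + k) * p = e (j + φ k)) → (∀ k : ℕ, p * e (j + k) * q = e (i + ψ k)) →
      (∀ k, ψ (φ k) = k) ∧ Monotone φ := by
    intro p q i j h φ ψ hφ hψ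
    refine ⟨fun k => ?_, fun k l hkl => ?_⟩
    · have := hψ (φ k)
      rw [← hφ] at this
      simp only [mul_assoc, h.pq, mul_eq_reassoc h.pq] at this
      rw [he.mul_of_ge (by omega), he.mul_of_le (by omega)] at this
      have := he.inj this
      omega
    · have := he.le_of_mul (m := j + φ k) (n := j + φ l) (by
        rw [← hφ, ← hφ]
        simp only [mul_assoc, mul_eq_reassoc h.pq]
        rw [mul_eq_reassoc (he.mul_of_le (show i ≤ i + l by omega)),
          mul_eq_reassoc (he.mul_of_le (by omega))])
      omega
  obtain ⟨h1, h2⟩ := aux h hφ hψ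
  obtain ⟨h3, h4⟩ := aux h.symm hψ hφ
  let E : ℕ ≃o ℕ :=
    { toFun := φ
      invFun := ψ
      left_inv := h1
      right_inv := h3
      map_rel_iff' := fun {a b} => ⟨fun hab => by simpa [h1] using h4 hab, fun hab => h2 hab⟩ }
  have hE : E = OrderIso.refl ℕ := Subsingleton.elim _ _
  have : φ k = k := congrArg (fun F : ℕ ≃o ℕ => F k) hE
  rw [hφ, this]

end IsIdempotentChain

/-! ### Coordinates and the isomorphism with Warne's semigroup. -/

/-- A coordinate system on a semigroup whose idempotents form a `ℤ`-chain `e`: elements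
`p n` and `q n` linking `e 0` to `e n`, which for `n ≥ 0` are the powers of `p 1` and `q 1`. -/
structure Frame (S : Type*) [Semigroup S] where
  e : ℤ → S
  chain : IsIdempotentChain e
  p : ℤ → S
  q : ℤ → S
  link : ∀ n, Linked (p n) (q n) (e 0) (e n)
  p_zero : p 0 = e 0
  q_zero : q 0 = e 0
  p_succ : ∀ n : ℕ, p (n + 1) = p 1 * p n
  q_succ : ∀ n : ℕ, q (n + 1) = q n * q 1

namespace Frame

/-- The maximal subgroup at the idempotent `e 0`. -/
structure Grp (F : Frame S) where
  val : S
  inv : S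
  link : Linked val inv (F.e 0) (F.e 0)

variable {F : Frame S}

theorem Grp.eq_of_val {g h : F.Grp} (H : g.val = h.val) : g = h := by
  obtain ⟨g, g', hg⟩ := g
  obtain ⟨h, h', hh⟩ := h
  obtain rfl : g = h := H
  obtain rfl := hg.inv_unique hh
  rfl

instance : Mul F.Grp := ⟨fun g h => ⟨g.val * h.val, h.inv * g.inv, g.link.trans h.link⟩⟩

instance : One F.Grp :=
  ⟨⟨F.e 0, F.e 0, by
    have := F.chain.mul_of_le (le_refl 0)
    exact ⟨this, this, this, this⟩⟩⟩

instance : Inv F.Grp := ⟨fun g => ⟨g.inv, g.val, g.link.symm⟩⟩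

theorem val_mul (g h : F.Grp) : (g * h).val = g.val * h.val := rfl
theorem val_one : (1 : F.Grp).val = F.e 0 := rfl
theorem val_inv (g : F.Grp) : g⁻¹.val = g.inv := rfl

instance : Group F.Grp :=
  Group.ofLeftAxioms (fun _ _ _ => Grp.eq_of_val (mul_assoc _ _ _))
    (fun g => Grp.eq_of_val g.link.ap) (fun g => Grp.eq_of_val g.link.qp)

variable (F)

theorem p_mul_e {m n : ℤ} (h : m ≤ n) : F.p n * F.e m = F.p n := by
  rw [← (F.link n).pb, mul_assoc, F.chain.mul_of_ge h]

theorem e_mul_q {m n : ℤ} (h : m ≤ n) : F.e m * F.q n = F.q n := by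
  rw [← (F.link n).bq, mul_eq_reassoc (F.chain.mul_of_le h)]

theorem p_conj (k : ℤ) : F.p k * F.e (k + 1) * F.q k = F.e 1 := by
  simpa using F.chain.conj (F.link k).symm 1

theorem q_conj (k : ℤ) : F.q k * F.e 1 * F.p k = F.e (k + 1) := by
  simpa using F.chain.conj (F.link k) 1

variable {F}

/-- Conjugation by `g` fixes `e 1`, being a shift from the tail at `e 0` to itself. This commutation
makes `endo` multiplicative, since `q 1 * p 1 = e 1`. -/
theorem val_mul_e_one (g : F.Grp) : g.val * F.e 1 = F.e 1 * g.val := by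
  have := F.chain.conj g.link.symm 1
  simp only [zero_add, Nat.cast_one] at this
  have h1 : F.e 1 = F.e 1 * F.e 0 := (F.chain.mul_of_ge zero_le_one).symm
  calc g.val * F.e 1 = g.val * (F.e 1 * F.e 0) := by rw [← h1]
    _ = (g.val * F.e 1 * g.inv) * g.val := by simp only [mul_assoc, g.link.qp]
    _ = _ := by rw [this]

theorem val_mul_e_zero (g : F.Grp) : g.val * F.e 0 = g.val := g.link.pb

theorem e_zero_mul_val (g : F.Grp) : F.e 0 * g.val = g.val := g.link.ap

variable (F)

theorem conj_one_mul (g h : F.Grp) :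
    F.p 1 * g.val * F.q 1 * (F.p 1 * h.val * F.q 1) = F.p 1 * (g * h).val * F.q 1 := by
  simp only [mul_assoc, mul_eq_reassoc (F.link 1).qp, val_mul]
  rw [mul_eq_reassoc (val_mul_e_one g), mul_assoc, mul_eq_reassoc (F.link 1).pb]

/-- The endomorphism `g ↦ p g q` of the maximal subgroup at `e 0`. -/
def endo : Monoid.End F.Grp :=
  MonoidHom.mk' (fun g =>
    { val := F.p 1 * g.val * F.q 1
      inv := F.p 1 * g.inv * F.q 1
      link :=
        { pq := by
            rw [← val_inv, conj_one_mul, mul_inv_cancel, val_one, F.p_mul_e zero_le_one,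
              (F.link 1).pq]
          qp := by
            rw [← val_inv, conj_one_mul, inv_mul_cancel, val_one, F.p_mul_e zero_le_one,
              (F.link 1).pq]
          ap := by rw [mul_assoc, mul_eq_reassoc (F.link 1).ap]
          qa := by rw [mul_assoc, (F.link 1).qa] } })
    fun g h => Grp.eq_of_val (F.conj_one_mul g h).symm

theorem endo_val (g : F.Grp) : (F.endo g).val = F.p 1 * g.val * F.q 1 := rfl

/-- The correction terms `u k`, measuring the failure of `p k = p 1 * p (k - 1)`. -/
def corr (k : ℤ) : F.Grp where
  val := F.p 1 * F.p (k - 1) * F.q k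
  inv := F.p k * F.q (k - 1) * F.q 1
  link :=
    { pq := by
        have := F.p_conj (k - 1)
        rw [sub_add_cancel] at this
        calc _ = F.p 1 * (F.p (k - 1) * (F.q k * F.p k) * F.q (k - 1)) * F.q 1 := by
              simp only [mul_assoc]
          _ = _ := by rw [(F.link k).qp, this, (F.link 1).pb, (F.link 1).pq]
      qp := by
        have := F.q_conj (k - 1)
        rw [sub_add_cancel] at this
        calc _ = F.p k * (F.q (k - 1) * (F.q 1 * F.p 1) * F.p (k - 1)) * F.q k := by
              simp only [mul_assoc]
          _ = _ := by rw [(F.link 1).qp, this, (F.link k).pb, (F.link k).pq]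
      ap := by simp only [mul_assoc, mul_eq_reassoc (F.link 1).ap]
      qa := by simp only [mul_assoc, (F.link 1).qa] }

theorem corr_val (k : ℤ) : (F.corr k).val = F.p 1 * F.p (k - 1) * F.q k := rfl

theorem corr_inv_val (k : ℤ) : (F.corr k)⁻¹.val = F.p k * F.q (k - 1) * F.q 1 := rfl

/-- Here the choice of powers for nonnegative indices is used. -/
theorem corr_eq_one (k : ℤ) (hk : 1 ≤ k) : F.corr k = 1 := by
  apply Grp.eq_of_val
  obtain ⟨n, rfl⟩ : ∃ n : ℕ, k = n + 1 := ⟨(k - 1).toNat, by omega⟩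
  rw [corr_val, add_sub_cancel_right, ← F.p_succ, (F.link _).pq, val_one]

/-- The one-step case of `p_mul_q`, from which its induction proceeds. -/
theorem corr_inv_mul (k : ℤ) : (F.corr (k + 1))⁻¹.val * F.p 1 = F.p (k + 1) * F.q k := by
  rw [corr_inv_val, add_sub_cancel_right]
  calc _ = F.p (k + 1) * (F.q k * F.e 1) := by simp only [mul_assoc, (F.link 1).qp]
    _ = F.p (k + 1) * (F.q k * F.e 1 * F.p k * F.q k) := by
      simp only [mul_assoc, (F.link k).pq]
      rw [F.chain.mul_of_ge zero_le_one]
    _ = _ := by rw [q_conj, ← mul_assoc, (F.link _).pb]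

theorem mul_corr (k : ℤ) : F.q 1 * (F.corr (k + 1)).val = F.p k * F.q (k + 1) := by
  rw [corr_val, add_sub_cancel_right]
  calc _ = F.e 1 * F.p k * F.q (k + 1) := by simp only [mul_assoc, mul_eq_reassoc (F.link 1).qp]
    _ = F.p k * (F.q k * F.e 1 * F.p k) * F.q (k + 1) := by
      simp only [mul_assoc, mul_eq_reassoc (F.link k).pq]
      rw [mul_eq_reassoc (F.chain.mul_of_le zero_le_one)]
    _ = _ := by rw [q_conj, mul_assoc, (F.link _).bq]

variable {F}

theorem p_one_mul_val (g : F.Grp) : F.p 1 * g.val = (F.endo g).val * F.p 1 := by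
  simp only [endo_val, mul_assoc, (F.link 1).qp, val_mul_e_one, mul_eq_reassoc (F.link 1).pb]

theorem val_mul_q_one (g : F.Grp) : g.val * F.q 1 = F.q 1 * (F.endo g).val := by
  simp only [endo_val, mul_assoc, mul_eq_reassoc (F.link 1).qp]
  rw [← mul_assoc, ← val_mul_e_one, mul_assoc, (F.link 1).bq]

theorem p_mul_val (d : ℕ) (g : F.Grp) : F.p d * g.val = ((F.endo ^ d) g).val * F.p d := by
  induction d with
  | zero => simp [F.p_zero, val_mul_e_zero, e_zero_mul_val]
  | succ d ih =>
    rw [Nat.cast_succ, F.p_succ, mul_assoc, ih, ← mul_assoc, p_one_mul_val, mul_assoc, pow_succ']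
    rfl

theorem val_mul_q (d : ℕ) (g : F.Grp) : g.val * F.q d = F.q d * ((F.endo ^ d) g).val := by
  induction d with
  | zero => simp [F.q_zero, val_mul_e_zero, e_zero_mul_val]
  | succ d ih =>
    rw [Nat.cast_succ, F.q_succ, ← mul_assoc, ih, mul_assoc, val_mul_q_one, mul_assoc, pow_succ']
    rfl

variable (F)

/-- The elements `f_{d,k}` for the endomorphism and the correction terms of a frame. -/
abbrev fac (d : ℕ) (k : ℤ) : F.Grp := warneF F.endo F.corr d k

theorem fac_succ (d : ℕ) (k : ℤ) : F.fac (d + 1) k = F.endo (F.fac d k) * F.corr (k + d + 1) := by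
  rw [fac, Warne.warneF_add]
  simp [warneF]

theorem fac_zero (k : ℤ) : F.fac 0 k = 1 := by simp [fac, warneF]

/-- Inserting `e (k + d) = q (k + d) * p (k + d)` splits off one step; moving `p 1` past the group
element applies `θ`, which is the recursion `fac_succ`. -/
theorem p_mul_q (d : ℕ) (k : ℤ) : F.p (k + d) * F.q k = (F.fac d k)⁻¹.val * F.p d := by
  induction d with
  | zero => simp [fac_zero, F.p_zero, (F.link k).pq, val_one, F.chain.mul_of_le (le_refl 0)]
  | succ d ih =>
    push_cast
    rw [F.p_succ, ← add_assoc, fac_succ, mul_inv_rev, ← map_inv, val_mul]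
    calc F.p (k + d + 1) * F.q k
        = F.p (k + d + 1) * F.e (k + d) * F.q k := by rw [F.p_mul_e (by omega)]
      _ = F.p (k + d + 1) * F.q (k + d) * (F.p (k + d) * F.q k) := by
          rw [← (F.link (k + d)).qp]; simp only [mul_assoc]
      _ = _ := by
          rw [ih, ← corr_inv_mul, mul_assoc, mul_eq_reassoc (p_one_mul_val _)]
          simp only [mul_assoc]

theorem p_mul_q' (d : ℕ) (k : ℤ) : F.p k * F.q (k + d) = F.q d * (F.fac d k).val := by
  induction d with
  | zero => simp [fac_zero, F.q_zero, (F.link k).pq, val_one, F.chain.mul_of_le (le_refl 0)]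
  | succ d ih =>
    push_cast
    rw [F.q_succ, ← add_assoc, fac_succ, val_mul]
    calc F.p k * F.q (k + d + 1)
        = F.p k * (F.e (k + d) * F.q (k + d + 1)) := by rw [F.e_mul_q (by omega)]
      _ = F.p k * F.q (k + d) * (F.p (k + d) * F.q (k + d + 1)) := by
          rw [← (F.link (k + d)).qp]; simp only [mul_assoc]
      _ = _ := by
          rw [ih, ← mul_corr, mul_assoc, mul_eq_reassoc (val_mul_q_one _)]
          simp only [mul_assoc]

theorem p_mul_p (d : ℕ) (l : ℤ) : F.p d * F.p l = (F.fac d l).val * F.p (l + d) := by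
  rw [← F.p_mul_e (show l ≤ l + d by omega), ← (F.link l).qp, mul_eq_reassoc (F.p_mul_q d l),
    mul_assoc, ← mul_assoc, ← val_mul, mul_inv_cancel, val_one, mul_eq_reassoc (F.link _).ap]

theorem q_mul_q (d : ℕ) (i : ℤ) : F.q i * F.q d = F.q (i + d) * (F.fac d i)⁻¹.val := by
  rw [← F.e_mul_q (show i ≤ i + d by omega), ← (F.link i).qp, mul_assoc (F.q i),
    F.p_mul_q' d i, mul_assoc, mul_assoc, ← val_mul, mul_inv_cancel, val_one, (F.link _).qa]

/-- The map `(i, g, j) ↦ q i * g * p j`. -/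
def ofWarne (x : Warne F.endo F.corr) : S := F.q x.left * x.val.val * F.p x.right

theorem ofWarne_mul (x y : Warne F.endo F.corr) :
    F.ofWarne (x * y) = F.ofWarne x * F.ofWarne y := by
  obtain ⟨a, g, b⟩ := x
  obtain ⟨c, h, d⟩ := y
  rcases le_total c b with hb | hb
  · obtain ⟨n, rfl⟩ : ∃ n : ℕ, b = c + n := ⟨(b - c).toNat, by omega⟩
    rw [Warne.mul_of_ge _ _ _ _ _ _ hb, show d - c + (c + n) = d + n by ring]
    simp only [ofWarne, add_sub_cancel_left, Int.toNat_natCast, val_mul, mul_assoc]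
    rw [mul_eq_reassoc (F.p_mul_q n c), mul_assoc, mul_eq_reassoc (p_mul_val n h), mul_assoc,
      F.p_mul_p]
  · obtain ⟨n, rfl⟩ : ∃ n : ℕ, c = b + n := ⟨(c - b).toNat, by omega⟩
    rw [Warne.mul_of_le _ _ _ _ _ _ hb, show a - b + (b + n) = a + n by ring]
    simp only [ofWarne, add_sub_cancel_left, Int.toNat_natCast, val_mul, mul_assoc]
    rw [mul_eq_reassoc (F.p_mul_q' n b), mul_assoc, mul_eq_reassoc (val_mul_q n g), mul_assoc,
      mul_eq_reassoc (F.q_mul_q n a), mul_assoc]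

theorem linked_ofWarne (i j : ℤ) (g : F.Grp) :
    Linked (F.ofWarne ⟨i, g, j⟩) (F.ofWarne ⟨j, g⁻¹, i⟩) (F.e i) (F.e j) := by
  have := ((F.link i).symm.trans g.link).trans (F.link j)
  rwa [← mul_assoc] at this

/-- The idempotents `x * x⁻¹ = e i` and `x⁻¹ * x = e j` determine the indices, and `p i * x * q j`
recovers the group coordinate. -/
theorem ofWarne_injective : Function.Injective F.ofWarne := by
  rintro ⟨i, g, j⟩ ⟨k, h, l⟩ H
  have h1 := F.linked_ofWarne i j g
  have h2 := F.linked_ofWarne k l h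
  rw [← H] at h2
  have hik : i = k := by
    apply le_antisymm <;> apply F.chain.le_of_mul
    · rw [← h2.pq, mul_eq_reassoc h1.ap]
    · rw [← h1.pq, mul_eq_reassoc h2.ap]
  have hjl : j = l := by
    apply le_antisymm <;> apply F.chain.le_of_mul
    · rw [F.chain.mul, max_comm, ← F.chain.mul, ← h2.qp, mul_assoc, h1.pb]
    · rw [F.chain.mul, max_comm, ← F.chain.mul, ← h1.qp, mul_assoc, h2.pb]
  subst hik hjl
  have : g = h := by
    apply Grp.eq_of_val
    have key : ∀ g : F.Grp, F.p i * F.ofWarne ⟨i, g, j⟩ * F.q j = g.val := fun g => by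
      simp only [ofWarne, mul_assoc, mul_eq_reassoc (F.link i).pq, (F.link j).pq, val_mul_e_zero,
        e_zero_mul_val]
    rw [← key g, ← key h, H]
  rw [this]

theorem ofWarne_surjective (hreg : IsRegularSemigroup S) : Function.Surjective F.ofWarne := by
  intro x
  obtain ⟨y, hy⟩ := hreg x
  have hxy : IsIdempotentElem (x * y) := by
    change x * y * (x * y) = x * y
    rw [← mul_assoc, ← hy]
  have hyx : IsIdempotentElem (y * x) := by
    change y * x * (y * x) = y * x
    rw [mul_assoc, ← mul_assoc x, ← hy]
  obtain ⟨a, ha⟩ := F.chain.surj _ hxy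
  obtain ⟨b, hb⟩ := F.chain.surj _ hyx
  -- `y` need not be an inverse of `x` in the strong sense, but `y * x * y` is; the group coordinate
  -- is then `p a * x * q b`.
  have hx : Linked x (y * x * y) (F.e a) (F.e b) :=
    { pq := by rw [ha, ← mul_assoc, ← mul_assoc, ← hy]
      qp := by rw [hb, mul_assoc, hyx.eq]
      ap := by rw [ha, ← hy]
      qa := by rw [ha, mul_assoc y, mul_assoc y, hxy.eq] }
  have hg := ((F.link a).trans hx).trans (F.link b).symm
  refine ⟨⟨a, ⟨_, _, hg⟩, b⟩, ?_⟩
  simp only [ofWarne, mul_assoc, mul_eq_reassoc (F.link a).qp, (F.link b).qp]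
  rw [hx.pb, hx.ap]

/-- The isomorphism of Warne's semigroup with a regular semigroup carrying a frame. -/
noncomputable def warneEquiv (hreg : IsRegularSemigroup S) : Warne F.endo F.corr ≃* S :=
  MulEquiv.ofBijective (⟨F.ofWarne, F.ofWarne_mul⟩ : Warne F.endo F.corr →ₙ* S)
    ⟨F.ofWarne_injective, F.ofWarne_surjective hreg⟩

end Frame

/-! ### Existence of a frame. -/

theorem exists_linked_of_greenD {a b : S} (ha : IsIdempotentElem a) (hb : IsIdempotentElem b)
    (h : GreenD a b) : ∃ p q, Linked p q a b := by
  obtain ⟨z, hL, hR⟩ := h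
  obtain ⟨s, hs⟩ : ∃ s, a = s * z := by
    have : a ∈ principalLeftIdeal z := hL ▸ Or.inl rfl
    rcases this with rfl | h
    · exact ⟨a, ha.eq.symm⟩
    · exact h
  obtain ⟨t, ht⟩ : ∃ t, b = z * t := by
    have : b ∈ principalRightIdeal z := hR ▸ Or.inl rfl
    rcases this with rfl | h
    · exact ⟨b, hb.eq.symm⟩
    · exact h
  have hza : z * a = z := by
    have : z ∈ principalLeftIdeal a := hL ▸ Or.inl rfl
    rcases this with rfl | ⟨w, rfl⟩
    · exact ha
    · rw [mul_assoc, ha.eq]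
  have hbz : b * z = z := by
    have : z ∈ principalRightIdeal b := hR ▸ Or.inl rfl
    rcases this with rfl | ⟨w, rfl⟩
    · exact hb
    · rw [← mul_assoc, hb.eq]
  -- The factor `b` trims `s`: with `b = z * t`, it gives `z * s * b = z * a * t = b`.
  exact ⟨s * b, z,
    { pq := by rw [mul_assoc, hbz, hs]
      qp := by rw [ht, mul_eq_reassoc hs.symm, mul_eq_reassoc hza]
      ap := by rw [ht, mul_eq_reassoc hs.symm, mul_eq_reassoc ha]
      qa := hza }⟩

theorem IsIBisimple.exists_chain (hI : IsIBisimple S) :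
    ∃ e : ℤ → S, IsIdempotentChain e := by
  obtain ⟨-, ⟨φ⟩⟩ := hI
  have key : ∀ m n : ℤ, n ≤ m → IdempotentLE (φ.symm m) (φ.symm n) := fun m n h =>
    φ.symm.map_rel_iff.mpr h
  refine ⟨fun n => φ.symm n, fun m n => ?_, fun m n h => ?_, fun x hx => ⟨φ ⟨x, hx⟩, by simp⟩⟩
  · rcases le_total n m with h | h
    · rw [max_eq_left h, (key m n h).1]
    · rw [max_eq_right h, (key n m h).2]
  · exact φ.symm.injective (Subtype.ext h)

theorem IsIBisimple.nonempty_frame (hI : IsIBisimple S) : Nonempty (Frame S) := by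
  obtain ⟨e, he⟩ := hI.exists_chain
  have hid : ∀ n, IsIdempotentElem (e n) := fun n => he.mul_of_le le_rfl
  choose p q hpq using fun n => exists_linked_of_greenD (hid 0) (hid n) (hI.1.2 _ _)
  -- Powers starting at `e 0` replace the chosen links for `n ≥ 0`; negative indices keep arbitrary
  -- links.
  let p' : ℕ → S := fun n => Nat.rec (e 0) (fun _ x => p 1 * x) n
  let q' : ℕ → S := fun n => Nat.rec (e 0) (fun _ x => x * q 1) n
  have hp0 : p' 0 = e 0 := rfl
  have hq0 : q' 0 = e 0 := rfl
  have hps : ∀ n, p' (n + 1) = p 1 * p' n := fun _ => rfl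
  have hqs : ∀ n, q' (n + 1) = q' n * q 1 := fun _ => rfl
  have hp : p 1 * e 0 = p 1 := by
    rw [← (hpq 1).pb, mul_assoc, he.mul_of_ge zero_le_one]
  have hq : e 0 * q 1 = q 1 := by
    rw [← (hpq 1).bq, mul_eq_reassoc (he.mul_of_le zero_le_one)]
  have hlink : ∀ n : ℕ, Linked (p' n) (q' n) (e 0) (e n) := by
    intro n
    induction n with
    | zero => exact ⟨hid 0, hid 0, hid 0, hid 0⟩
    | succ n ih =>
      have h1 := hpq 1
      refine ⟨?_, ?_, ?_, ?_⟩
      · rw [hps, hqs, mul_assoc, mul_eq_reassoc ih.pq, ← mul_assoc, hp, h1.pq]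
      · have := he.conj ih 1
        push_cast
        rw [hps, hqs, mul_assoc, mul_eq_reassoc h1.qp, ← mul_assoc]
        simpa using this
      · rw [hps, mul_eq_reassoc h1.ap]
      · rw [hqs, mul_assoc, h1.qa]
  have hp1 : p' 1 = p 1 := hp
  have hq1 : q' 1 = q 1 := hq
  refine ⟨{
    e := e
    chain := he
    p := fun n => if 0 ≤ n then p' n.toNat else p n
    q := fun n => if 0 ≤ n then q' n.toNat else q n
    link := fun n => ?_
    p_zero := by simp [hp0]
    q_zero := by simp [hq0]
    p_succ := fun n => ?_
    q_succ := fun n => ?_ }⟩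
  · split_ifs with h
    · simpa [h] using hlink n.toNat
    · exact hpq n
  · have : (0 : ℤ) ≤ n + 1 := by omega
    simp [this, hp1, hps]
  · have : (0 : ℤ) ≤ n + 1 := by omega
    simp [this, hq1, hqs]

end Algebra


/-! ### Topological consequences of separate continuity. -/

section Topology

namespace Warne

variable {G : Type*} [Group G] {θ : Monoid.End G} {u : ℤ → G}

theorem one_mul_mk (k i j : ℤ) (g : G) :
    (⟨k, 1, i⟩ * ⟨i, g, j⟩ : Warne θ u) = ⟨k, g, j⟩ := by
  rw [mul_of_ge _ _ _ _ _ _ le_rfl]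
  simp [warneF]

theorem mk_mul_one (i j l : ℤ) (g : G) :
    (⟨i, g, j⟩ * ⟨j, 1, l⟩ : Warne θ u) = ⟨i, g, l⟩ := by
  rw [mul_of_le _ _ _ _ _ _ le_rfl]
  simp [warneF]

theorem diag_one_mul_left (i : ℤ) (x : Warne θ u) :
    (⟨i, 1, i⟩ * x : Warne θ u).left = max i x.left := by
  obtain ⟨a, g, b⟩ := x
  rcases le_total a i with h | h
  · rw [mul_of_ge _ _ _ _ _ _ h, max_eq_left h]
  · rw [mul_of_le _ _ _ _ _ _ h, max_eq_right h]
    simp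

theorem diag_one_mul_right (i : ℤ) (x : Warne θ u) (h : x.left ≤ i) :
    (⟨i, 1, i⟩ * x : Warne θ u).right = x.right - x.left + i := by
  obtain ⟨a, g, b⟩ := x
  rw [mul_of_ge _ _ _ _ _ _ h]

theorem mul_diag_one_right (j : ℤ) (x : Warne θ u) :
    (x * ⟨j, 1, j⟩ : Warne θ u).right = max j x.right := by
  obtain ⟨a, g, b⟩ := x
  rcases le_total j b with h | h
  · rw [mul_of_ge _ _ _ _ _ _ h, max_eq_right h]
    simp
  · rw [mul_of_le _ _ _ _ _ _ h, max_eq_left h]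

theorem mul_diag_one_left (j : ℤ) (x : Warne θ u) (h : x.right ≤ j) :
    (x * ⟨j, 1, j⟩ : Warne θ u).left = x.left - x.right + j := by
  obtain ⟨a, g, b⟩ := x
  rw [mul_of_le _ _ _ _ _ _ h]

theorem diag_one_mul_eq_iff (i : ℤ) (x : Warne θ u) :
    (⟨i, 1, i⟩ * x : Warne θ u) = x ↔ i ≤ x.left := by
  refine ⟨fun h => ?_, fun h => ?_⟩
  · rw [← h, diag_one_mul_left]
    exact le_max_left _ _
  · obtain ⟨a, g, b⟩ := x
    rw [mul_of_le _ _ _ _ _ _ h]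
    simp

theorem mul_diag_one_eq_iff (j : ℤ) (x : Warne θ u) :
    (x * ⟨j, 1, j⟩ : Warne θ u) = x ↔ j ≤ x.right := by
  refine ⟨fun h => ?_, fun h => ?_⟩
  · rw [← h, mul_diag_one_right]
    exact le_max_left _ _
  · obtain ⟨a, g, b⟩ := x
    rw [mul_of_ge _ _ _ _ _ _ h]
    simp

theorem mul_one_corner (k i j l : ℤ) (g : G) :
    (⟨k, 1, i⟩ * ⟨i, g, j⟩ * ⟨j, 1, l⟩ : Warne θ u) = ⟨k, g, l⟩ := by
  rw [one_mul_mk, mk_mul_one]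

theorem corner_mem_block {i j : ℤ} (k l : ℤ) {x : Warne θ u} (hx : x ∈ block θ u i j) :
    ⟨k, 1, i⟩ * x * ⟨j, 1, l⟩ ∈ block θ u k l := by
  obtain ⟨g, rfl⟩ := hx
  exact ⟨g, mul_one_corner ..⟩

/-- Exhibits `θ` on `G_{i,i}` as a two-sided translation; since `f_{1,i} = u (i + 1)`, the outer
factors cancel the corrections. -/
theorem mk_endo (i : ℤ) (g : G) :
    (⟨i, u (i + 1), i + 1⟩ * ⟨i, g, i⟩ * ⟨i + 1, (u (i + 1))⁻¹, i⟩ : Warne θ u) =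
      ⟨i, θ g, i⟩ := by
  rw [mul_of_ge _ _ _ _ _ _ (by omega : i ≤ i + 1), show i - i + (i + 1) = i + 1 by ring,
    mul_of_ge _ _ _ _ _ _ le_rfl]
  simp [warneF]

variable [TopologicalSpace (Warne θ u)] [SeparatelyContinuousMul (Warne θ u)]

theorem continuous_mul_mul (a b : Warne θ u) : Continuous fun x => a * x * b :=
  (SeparatelyContinuousMul.continuous_mul_const (a := b)).comp
    (SeparatelyContinuousMul.continuous_const_mul (a := a))

/-- Translations identify the blocks `G_{i,j}` and `G_{k,l}`. -/
def blockHomeomorph (i j k l : ℤ) : block θ u i j ≃ₜ block θ u k l where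
  toFun x := ⟨⟨k, 1, i⟩ * x.1 * ⟨j, 1, l⟩, corner_mem_block k l x.2⟩
  invFun x := ⟨⟨i, 1, k⟩ * x.1 * ⟨l, 1, j⟩, corner_mem_block i j x.2⟩
  left_inv := by
    rintro ⟨_, g, rfl⟩
    exact Subtype.ext (by simp only [mul_one_corner])
  right_inv := by
    rintro ⟨_, g, rfl⟩
    exact Subtype.ext (by simp only [mul_one_corner])
  continuous_toFun := ((continuous_mul_mul _ _).comp continuous_subtype_val).subtype_mk _
  continuous_invFun := ((continuous_mul_mul _ _).comp continuous_subtype_val).subtype_mk _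

theorem continuous_diagEquiv (i k : ℤ) :
    Continuous fun x : diag θ u i => diagEquiv θ u k ((diagEquiv θ u i).symm x) := by
  refine continuous_induced_rng.mpr
    (((continuous_mul_mul ⟨k, 1, i⟩ ⟨i, 1, k⟩).comp continuous_subtype_val).congr ?_)
  rintro ⟨_, g, rfl⟩
  exact mul_one_corner ..

/-- The canonical topological isomorphism between the groups `G_{i,i}` and `G_{k,k}`. -/
def diagContinuousMulEquiv (i k : ℤ) : diag θ u i ≃ₜ* diag θ u k where
  __ := (diagEquiv θ u i).symm.trans (diagEquiv θ u k)
  continuous_toFun := continuous_diagEquiv i k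
  continuous_invFun := continuous_diagEquiv k i

theorem continuous_diag_endo (i : ℤ) :
    Continuous fun x : diag θ u i => diagEquiv θ u i (θ ((diagEquiv θ u i).symm x)) := by
  refine continuous_induced_rng.mpr
    (((continuous_mul_mul ⟨i, u (i + 1), i + 1⟩ ⟨i + 1, (u (i + 1))⁻¹, i⟩).comp
      continuous_subtype_val).congr ?_)
  rintro ⟨_, g, rfl⟩
  exact mk_endo i g

variable [T2Space (Warne θ u)]

theorem isSemitopologicalGroup_diag (i : ℤ) : IsSemitopologicalGroup (diag θ u i) where
  t2 := inferInstance
  separatelyContinuous := inferInstance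
  assoc := mul_assoc
  exists_one_inv := by
    have key : ∀ x : diag θ u i, ∃ g, diagEquiv θ u i g = x := (diagEquiv θ u i).surjective
    refine ⟨diagEquiv θ u i 1, fun x => ?_, fun x => ?_⟩
    · obtain ⟨g, rfl⟩ := key x
      simp only [← map_mul, one_mul, mul_one, and_self]
    · obtain ⟨g, rfl⟩ := key x
      exact ⟨diagEquiv θ u i g⁻¹, by rw [← map_mul, mul_inv_cancel],
        by rw [← map_mul, inv_mul_cancel]⟩

/-- The complement is the fixed-point set of left translation by the idempotent at `i + 1`. -/
theorem isOpen_left_le (i : ℤ) : IsOpen {x : Warne θ u | x.left ≤ i} := by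
  have : IsClosed {x : Warne θ u | ⟨i + 1, 1, i + 1⟩ * x = x} :=
    isClosed_eq SeparatelyContinuousMul.continuous_const_mul continuous_id
  convert this.isOpen_compl using 1
  ext x
  simp only [Set.mem_ofPred_eq, Set.mem_compl_iff, diag_one_mul_eq_iff]
  omega

theorem isOpen_right_le (j : ℤ) : IsOpen {x : Warne θ u | x.right ≤ j} := by
  have : IsClosed {x : Warne θ u | x * ⟨j + 1, 1, j + 1⟩ = x} :=
    isClosed_eq SeparatelyContinuousMul.continuous_mul_const continuous_id
  convert this.isOpen_compl using 1
  ext x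
  simp only [Set.mem_ofPred_eq, Set.mem_compl_iff, mul_diag_one_eq_iff]
  omega

theorem exists_isOpen_subset_iUnion_block (i : ℤ) (g : G) (j : ℤ) :
    ∃ U : Set (Warne θ u), IsOpen U ∧ ⟨i, g, j⟩ ∈ U ∧
      U ⊆ ⋃ k : ℕ, block θ u (i - k) (j - k) := by
  refine ⟨({x | x.left ≤ i} ∩ {x | x.right ≤ j}) ∩
    ((fun x => ⟨i, 1, i⟩ * x) ⁻¹' {x | x.right ≤ j} ∩
      (fun x => x * ⟨j, 1, j⟩) ⁻¹' {x | x.left ≤ i}), ?_, ?_, ?_⟩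
  · exact ((isOpen_left_le i).inter (isOpen_right_le j)).inter
      (((isOpen_right_le j).preimage SeparatelyContinuousMul.continuous_const_mul).inter
        ((isOpen_left_le i).preimage SeparatelyContinuousMul.continuous_mul_const))
  · simp [one_mul_mk, mk_mul_one]
  · rintro x ⟨⟨h1, h2⟩, h3, h4⟩
    simp only [Set.mem_ofPred_eq, Set.mem_preimage] at h1 h2 h3 h4
    -- The two translated conditions bound `x.right - x.left` by `j - i` from above and from below,
    -- so `x` lies on the right diagonal.
    rw [diag_one_mul_right i x h1] at h3
    rw [mul_diag_one_left j x h2] at h4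
    refine Set.mem_iUnion.mpr ⟨(i - x.left).toNat, x.val, ?_⟩
    ext
    · simp only; omega
    · rfl
    · simp only; omega

end Warne

theorem IsIdempotentChain.discreteTopology {S : Type*} [Semigroup S] [TopologicalSpace S]
    [T2Space S] [SeparatelyContinuousMul S] {e : ℤ → S} (he : IsIdempotentChain e) :
    DiscreteTopology {x : S | IsIdempotentElem x} := by
  rw [discreteTopology_iff_isOpen_singleton]
  rintro ⟨x, hx⟩
  obtain ⟨i, rfl⟩ := he.surj x hx
  have h1 : IsClosed {x : S | e (i + 1) * x = x} :=
    isClosed_eq SeparatelyContinuousMul.continuous_const_mul continuous_id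
  have h2 : IsClosed {x : S | e (i - 1) * x = e (i - 1)} :=
    isClosed_eq SeparatelyContinuousMul.continuous_const_mul continuous_const
  convert (h1.isOpen_compl.inter h2.isOpen_compl).preimage continuous_subtype_val using 1
  ext ⟨y, hy⟩
  obtain ⟨k, rfl⟩ := he.surj y hy
  -- The two inequations exclude `k ≥ i + 1` and `k ≤ i - 1` respectively.
  have : e k = e i ↔ ¬ e (i + 1) * e k = e k ∧ ¬ e (i - 1) * e k = e (i - 1) := by
    rw [he.mul, he.mul, he.inj.eq_iff, he.inj.eq_iff, he.inj.eq_iff]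
    omega
  exact Subtype.mk_eq_mk.trans this

end Topology

theorem theorem3p2 {S : Type v} [Semigroup S] [TopologicalSpace S] [T2Space S]
    [SeparatelyContinuousMul S] (hreg : IsRegularSemigroup S) (hI : IsIBisimple S) :
    ∃ (G : Type v) (_ : Group G) (θ : Monoid.End G) (u : ℤ → G)
      (_ : TopologicalSpace (Warne θ u)),
      (∀ n : ℤ, 1 ≤ n → u n = 1) ∧
      -- (i)
      (T2Space (Warne θ u) ∧ SeparatelyContinuousMul (Warne θ u) ∧
        Nonempty (S ≃ₜ* Warne θ u)) ∧
      -- (ii)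
      (∀ i j k l : ℤ, Nonempty (Warne.block θ u i j ≃ₜ Warne.block θ u k l)) ∧
      -- (iii)
      ((∀ i : ℤ, IsSemitopologicalGroup (Warne.diag θ u i)) ∧
        ∀ i k : ℤ, Nonempty (Warne.diag θ u i ≃ₜ* Warne.diag θ u k)) ∧
      -- (iv)
      (∀ i : ℤ, Continuous fun x : Warne.diag θ u i =>
        Warne.diagEquiv θ u i (θ ((Warne.diagEquiv θ u i).symm x))) ∧
      -- (v)
      (∀ (i : ℤ) (g : G) (j : ℤ), ∃ U : Set (Warne θ u), IsOpen U ∧ ⟨i, g, j⟩ ∈ U ∧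
        U ⊆ ⋃ k : ℕ, Warne.block θ u (i - k) (j - k)) ∧
      -- (vi)
      DiscreteTopology {e : S | IsIdempotentElem e} := by
  obtain ⟨F⟩ := hI.nonempty_frame
  let Φ := F.warneEquiv hreg
  let _ : TopologicalSpace (Warne F.endo F.corr) := .induced Φ inferInstance
  have hΦ : Topology.IsInducing Φ := ⟨rfl⟩
  let Ψ : Warne F.endo F.corr ≃ₜ S := Φ.toEquiv.toHomeomorphOfIsInducing hΦ
  have : T2Space (Warne F.endo F.corr) := Ψ.isEmbedding.t2Space
  have : SeparatelyContinuousMul (Warne F.endo F.corr) := hΦ.separatelyContinuousMul Φ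
  exact ⟨F.Grp, inferInstance, F.endo, F.corr, inferInstance, F.corr_eq_one,
    ⟨inferInstance, inferInstance,
      ⟨{ Φ.symm with
          continuous_toFun := Ψ.symm.continuous
          continuous_invFun := Ψ.continuous }⟩⟩,
    fun i j k l => ⟨Warne.blockHomeomorph i j k l⟩,
    ⟨Warne.isSemitopologicalGroup_diag, fun i k => ⟨Warne.diagContinuousMulEquiv i k⟩⟩,
    Warne.continuous_diag_endo, Warne.exists_isOpen_subset_iUnion_block,
    F.chain.discreteTopology⟩
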